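/- Let $R$ be a commutative Artinian ring and let $A$ be an Artin $R$-algebra, i.e. an $R$-algebra that is finitely generated as an $R$-module. Write $\mathrm{pd}$ and $\mathrm{id}$ for projective and injective dimension, and $A^{\mathsf o}$ for the opposite ring of $A$, so that left $A^{\mathsf o}$-modules are right $A$-modules. For a left $A$-module $M$ put $$\mathrm{ext.deg}(M)=\sup\{\,i\ge 0 \mid \mathrm{Ext}^i_A(M,M)\neq 0\,\},$$ and let $\mathrm{fed}(A)$ be the supremum of the finite values of $\mathrm{ext.deg}(M)$, where $M$ runs over the finitely generated left $A$-modules. (All these invariants take values in $\{-\infty\}\cup\mathbb N\cup\{\infty\}$; the zero module has projective dimension, injective dimension and extension degree $-\infty$.) One says that $A$ satisfies the Generalized Auslander–Reiten Condition (GARC) if for every finitely generated left $A$-module $M$ and every $n\in\mathbb N$ with $\mathrm{Ext}^i_A(M,M\oplus A)=0$ for all $i>n$ one has $\mathrm{pd}_A(M)\le n$. The ring $A$ is Gorenstein if $\mathrm{id}_A(A)$ and $\mathrm{id}_{A^{\mathsf o}}(A)$ are both finite. Let $J$ be an injective envelope of the $R$-module $R/\mathrm{rad}\,R$ and let $D=\mathrm{Hom}_R(-,J)$,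 which sends left $A^{\mathsf o}$-modules to left $A$-modules; thus $D({}_{A^{\mathsf o}}A)=\mathrm{Hom}_R(A,J)$ with $(af)(x)=f(xa)$. 1. If $A$ satisfies (GARC), then $$\mathrm{id}_{A^{\mathsf o}}(A)=\mathrm{ext.deg}\big(D({}_{A^{\mathsf o}}A)\oplus A\big)\le \mathrm{id}_A(A).$$ If, in addition, $\mathrm{id}_A(A)<\infty$, then equality also holds on the right, so that $\mathrm{id}_{A^{\mathsf o}}(A)=\mathrm{id}_A(A)<\infty$ and $A$ is Gorenstein. 2. In particular, if $\mathrm{fed}(A)<\infty$, then the Gorenstein Symmetry Question has a positive answer for $A$: if $\mathrm{id}_A(A)<\infty$, then $\mathrm{id}_{A^{\mathsf o}}(A)<\infty$, i.e. $A$ is Gorenstein. -/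

import Mathlib

open CategoryTheory

universe u

noncomputable section

section ExtensionDegree

variable (A : Type u) [Ring A]

/-- The self-extension degree `sup {i | Ext_A^i(M, M) ≠ 0}` of a left `A`-module `M`. Values are
taken in `{-∞} ∪ ℕ ∪ {∞}` (`WithBot ℕ∞`), where projective and injective dimensions also live;
the value `-∞ = ⊥` occurs only for `M = 0`. -/
def extDeg (M : Type u) [AddCommGroup M] [Module A M] : WithBot ℕ∞ :=
  sSup {d | ∃ i : ℕ, d = (i : WithBot ℕ∞) ∧
    Nontrivial (Abelian.Ext (ModuleCat.of A M) (ModuleCat.of A M) i)}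

/-- The finitistic extension degree: the supremum of the finite self-extension degrees of the
finitely generated left `A`-modules. -/
def finitisticExtDeg : WithBot ℕ∞ :=
  sSup {d | d < ⊤ ∧ ∃ (M : Type u) (_ : AddCommGroup M) (_ : Module A M),
    Module.Finite A M ∧ d = extDeg A M}

/-- The Generalized Auslander-Reiten Condition (GARC): every finitely generated left `A`-module
`M` with `Ext_A^i(M, M ⊕ A) = 0` for all `i > n` satisfies `pd_A(M) ≤ n`. -/
def SatisfiesGARC : Prop :=
  ∀ (M : Type u) [AddCommGroup M] [Module A M] [Module.Finite A M] (n : ℕ),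
    (∀ i : ℕ, n < i →
      Subsingleton (Abelian.Ext (ModuleCat.of A M) (ModuleCat.of A (M × A)) i)) →
    projectiveDimension (ModuleCat.of A M) ≤ (n : WithBot ℕ∞)

/-- The injective dimension `id_A(A)` of `A` as a left module over itself. -/
def leftSelfInjDim : WithBot ℕ∞ :=
  injectiveDimension (ModuleCat.of A A)

/-- The injective dimension `id_{Aᵒ}(A)` of `A` as a right module over itself, that is, as a left
module over the opposite ring. -/
def rightSelfInjDim : WithBot ℕ∞ :=
  injectiveDimension (ModuleCat.of Aᵐᵒᵖ A)

/-- `A` is Gorenstein if it has finite injective dimension on both sides. -/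
def IsGorensteinRing : Prop :=
  leftSelfInjDim A < ⊤ ∧ rightSelfInjDim A < ⊤

end ExtensionDegree

section InjectiveEnvelope

variable {R : Type u} [Ring R] {M J : Type u} [AddCommGroup M] [Module R M]
  [AddCommGroup J] [Module R J]

/-- `ι : M → J` is an injective envelope of `M`: `ι` is an essential monomorphism into an
injective module. -/
structure IsInjectiveEnvelope (ι : M →ₗ[R] J) : Prop where
  injective_module : Module.Injective R J
  injective : Function.Injective ι
  essential : ∀ N : Submodule R J, N ⊓ LinearMap.range ι = ⊥ → N = ⊥

/-- Every module has an injective envelope. -/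
theorem exists_injectiveEnvelope (R : Type u) [Ring R] (M : Type u) [AddCommGroup M]
    [Module R M] :
    ∃ (J : Type u) (_ : AddCommGroup J) (_ : Module R J) (ι : M →ₗ[R] J),
      IsInjectiveEnvelope ι := by
  -- an injective module containing `M`
  let pr := (EnoughInjectives.presentation (ModuleCat.of R M)).some
  have hE : Module.Injective R pr.J := Module.injective_module_of_injective_object R pr.J
    (inj := pr.injective)
  obtain ⟨E, hE1, hE2, f, hE, hf⟩ : ∃ (E : Type u) (_ : AddCommGroup E) (_ : Module R E)
      (f : M →ₗ[R] E), Module.Injective R E ∧ Function.Injective f :=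
    ⟨pr.J, inferInstance, inferInstance, pr.f.hom, hE, (ModuleCat.mono_iff_injective pr.f).1 pr.mono⟩
  -- a maximal essential extension `K` of the range inside `E`
  let P : Set (Submodule R E) := {K | LinearMap.range f ≤ K ∧
    ∀ N : Submodule R E, N ≤ K → N ⊓ LinearMap.range f = ⊥ → N = ⊥}
  obtain ⟨K, -, hK⟩ := zorn_le_nonempty₀ P (fun c hc hchain y hy => by
    refine ⟨sSup c, ⟨(hc hy).1.trans (le_sSup hy), fun N hN hN0 => ?_⟩, fun z hz => le_sSup hz⟩
    rw [Submodule.eq_bot_iff]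
    intro x hx
    obtain ⟨z, hz, hxz⟩ := (Submodule.mem_sSup_of_directed ⟨y, hy⟩ hchain.directedOn).1 (hN hx)
    have h := (hc hz).2 (Submodule.span R {x}) ((Submodule.span_singleton_le_iff_mem _ _).2 hxz)
      (le_bot_iff.1 (hN0 ▸ inf_le_inf_right _ ((Submodule.span_singleton_le_iff_mem _ _).2 hx)))
    exact Submodule.span_singleton_eq_bot.1 h)
    (LinearMap.range f) ⟨le_rfl, fun N hN h => by rwa [inf_eq_left.2 hN] at h⟩
  -- a maximal submodule `C` meeting `K` trivially
  obtain ⟨C, -, hC⟩ := zorn_le_nonempty₀ {C : Submodule R E | Disjoint C K}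
    (fun c hc hchain y hy => by
      refine ⟨sSup c, ?_, fun z hz => le_sSup hz⟩
      rw [Set.mem_ofPred_eq, Submodule.disjoint_def]
      intro x hx hxK
      obtain ⟨z, hz, hxz⟩ := (Submodule.mem_sSup_of_directed ⟨y, hy⟩ hchain.directedOn).1 hx
      exact (Submodule.disjoint_def.1 (hc hz)) x hxz hxK)
    ⊥ disjoint_bot_left
  have hCK : Disjoint C K := hC.prop
  -- the map `K → E / C` is injective, and the inclusion of `K` extends along it
  have hi : Function.Injective (C.mkQ ∘ₗ K.subtype) := by
    rw [← LinearMap.ker_eq_bot, Submodule.eq_bot_iff]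
    rintro ⟨x, hx⟩ h
    have : x ∈ C := by simpa using h
    exact Subtype.ext (Submodule.disjoint_def.1 hCK x this hx)
  obtain ⟨g, hg⟩ := hE.out (C.mkQ ∘ₗ K.subtype) hi K.subtype
  have hgK : ∀ x ∈ K, g (C.mkQ x) = x := fun x hx => hg ⟨x, hx⟩
  let p : E →ₗ[R] E := g ∘ₗ C.mkQ
  have hpC : ∀ x ∈ C, p x = 0 := fun x hx => by
    simp [p, (Submodule.Quotient.mk_eq_zero C).2 hx]
  have hker : LinearMap.ker p = C := by
    refine le_antisymm (hC.le_of_ge (y := LinearMap.ker p) ?_ hpC) hpC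
    rw [Set.mem_ofPred_eq, Submodule.disjoint_def]
    intro x hx hxK
    rw [← hgK x hxK]; exact hx
  -- the range of `p` is an essential extension of `K`, hence equal to `K`
  have hKp : K ≤ LinearMap.range p := fun x hx => ⟨x, hgK x hx⟩
  have hrange : LinearMap.range p = K := by
    refine le_antisymm (hK.le_of_ge (y := LinearMap.range p)
      ⟨hK.prop.1.trans hKp, fun N hN hN0 => ?_⟩ hKp) hKp
    have hNK : N ⊓ K = ⊥ := hK.prop.2 _ inf_le_right
      (le_bot_iff.1 (hN0 ▸ inf_le_inf_right _ inf_le_left))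
    have hcomap : N.comap p ≤ C := hC.le_of_ge (y := N.comap p) (by
      rw [Set.mem_ofPred_eq, Submodule.disjoint_def]
      intro x hx hxK
      have h1 : p x = x := hgK x hxK
      have h2 : x ∈ N ⊓ K := ⟨h1 ▸ hx, hxK⟩
      rw [hNK] at h2
      exact h2) (fun x hx => by
        change p x ∈ N
        rw [hpC x hx]; exact N.zero_mem)
    rw [Submodule.eq_bot_iff]
    intro x hx
    obtain ⟨y, rfl⟩ := hN hx
    exact hpC y (hcomap hx)
  -- so `K` is a retract of `E`, hence injective
  have hpK : ∀ x, p x ∈ K := fun x => hrange ▸ ⟨x, rfl⟩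
  refine ⟨K, inferInstance, inferInstance, f.codRestrict K (fun m => hK.prop.1 ⟨m, rfl⟩),
    ⟨⟨fun X Y _ _ _ _ a ha b => ?_⟩, fun x y h => hf (congrArg Subtype.val h), fun N hN => ?_⟩⟩
  · obtain ⟨h, hh⟩ := hE.out a ha (K.subtype ∘ₗ b)
    refine ⟨(p.codRestrict K hpK) ∘ₗ h, fun x => Subtype.ext ?_⟩
    simp only [LinearMap.comp_apply, LinearMap.codRestrict_apply, hh]
    exact hgK _ (b x).2
  · have := hK.prop.2 (N.map K.subtype) (Submodule.map_subtype_le K N) (by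
      rw [Submodule.eq_bot_iff]
      rintro _ ⟨⟨x, hx, rfl⟩, ⟨m, hm⟩⟩
      have h2 : x ∈ N ⊓ LinearMap.range (f.codRestrict K (fun m => hK.prop.1 ⟨m, rfl⟩)) :=
        ⟨hx, m, Subtype.ext hm⟩
      rw [hN, Submodule.mem_bot] at h2
      rw [h2, map_zero])
    refine Submodule.map_injective_of_injective K.subtype_injective ?_
    rw [this, Submodule.map_bot]

end InjectiveEnvelope

section Dual

/-- For a right `A`-module `N` (a left `Aᵐᵒᵖ`-module) over an `R`-algebra `A` and an `R`-module
`J`, this is `Hom_R(N, J)`, made into a left `A`-module below. When `A` is an Artin `R`-algebra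
and `J` is an injective envelope of `R / rad R`, it is the standard duality
`D : Aᵒ-mod → A-mod`. -/
def ArtinDual (R : Type u) [CommRing R] (J : Type u) [AddCommGroup J] [Module R J]
    (N : Type u) [AddCommGroup N] [Module R N] : Type u :=
  N →ₗ[R] J

variable (R : Type u) [CommRing R] (J : Type u) [AddCommGroup J] [Module R J]
  (N : Type u) [AddCommGroup N] [Module R N]

instance : AddCommGroup (ArtinDual R J N) :=
  inferInstanceAs (AddCommGroup (N →ₗ[R] J))

variable (A : Type u) [Ring A] [Module Aᵐᵒᵖ N] [SMulCommClass Aᵐᵒᵖ R N]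

/-- The left action `(a • f)(x) = f(x · a)`. -/
instance : Module A (ArtinDual R J N) where
  smul a f := LinearMap.comp (f : N →ₗ[R] J)
    ({ toFun := fun x => MulOpposite.op a • x
       map_add' := smul_add _
       map_smul' := fun r x => smul_comm (MulOpposite.op a) r x } : N →ₗ[R] N)
  one_smul f := LinearMap.ext fun x => congrArg (show N →ₗ[R] J from f) (one_smul Aᵐᵒᵖ x)
  mul_smul a b f := LinearMap.ext fun x => congrArg (show N →ₗ[R] J from f)
    (mul_smul (MulOpposite.op b) (MulOpposite.op a) x)
  smul_zero _ := rfl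
  smul_add _ _ _ := rfl
  add_smul a b f := LinearMap.ext fun x =>
    (congrArg (show N →ₗ[R] J from f) (add_smul (MulOpposite.op a) (MulOpposite.op b) x)).trans
      (LinearMap.map_add (show N →ₗ[R] J from f) _ _)
  zero_smul f := LinearMap.ext fun x =>
    (congrArg (show N →ₗ[R] J from f) (zero_smul Aᵐᵒᵖ x)).trans (LinearMap.map_zero (show N →ₗ[R] J from f))

end Dual

end

/-!
Write `D(A) = Hom_R(A, J)`, an injective left `A`-module, `l` for the left and `r` for the right
self-injective dimension of `A`, and `e` for the extension degree of `M = D(A) ⊕ A`. As `D(A)` is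
injective and `A` is projective, the only self-extensions of `M` in positive degrees are those in
`Ext^i(D(A), A)`; hence `e ≤ l` and `e ≤ pd D(A)`.

* Duality gives `r = pd D(A)` (`hasProjectiveDimensionLT_artinDual_iff`). Finite length
  `R`-modules are reflexive for `J` (`IsInjectiveEnvelope.isReflexiveModule`): this passes along
  extensions and to quotients, and `Hom_R(R / rad R, J)` is isomorphic to `R / rad R` because
  `R / rad R → J` is essential. Then `K ↦ Hom_R(K, J)` exchanges projective dimension of finitely
  generated left modules and injective dimension of right modules
  (`RightDual.hasProjectiveDimensionLT_iff`), and it sends `D(A)` to `A`.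
* (GARC) for `M` says `pd M ≤ e` when `e` is finite, so `r ≤ e`; thus `r = e ≤ l`.
* If `l` is finite, then `l ≤ e`. For `l ≥ 1`, Baer's criterion gives a left ideal `I` with
  `Ext^l(A / I, A) ≠ 0`; a cyclic module embeds into a finite power of the cogenerator `D(A)`, and
  `Ext^l(-, A)` turns injections into surjections as `Ext^{l+1}(-, A) = 0`. Therefore
  `Ext^l(D(A), A) ≠ 0` (`hasInjectiveDimensionLT_of_succ`).
* If `l` and `fed A` are finite, then so is `pd D(A)`. More generally, let `M` be finitely generated
  with `Ext^i(M, M ⊕ A) = 0` for large `i`. The `k`-th syzygy `Y` of `M` satisfies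
  `Ext^k(M, Y) ≠ 0` when `pd M ≥ k ≥ 1`, while `M ⊕ Y` has finite extension degree; so
  `pd M < ∞` (`exists_hasProjectiveDimensionLT`). This makes no use of (GARC).
-/

/-! ### Vanishing of `Ext` along short exact sequences -/

section ExtVanishing

open Limits Abelian

universe v w

variable {C : Type w} [Category.{v} C] [Abelian C] [HasExt.{v} C]

theorem subsingleton_ext_of_retract_left {X X' : C} (h : Retract X X') (Y : C) (i : ℕ)
    [Subsingleton (Ext X' Y i)] : Subsingleton (Ext X Y i) := by
  refine subsingleton_of_forall_eq 0 fun e => ?_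
  have : (Ext.mk₀ h.i).comp ((Ext.mk₀ h.r).comp e (zero_add i)) (zero_add i) = e := by simp
  rw [← this, Subsingleton.elim ((Ext.mk₀ h.r).comp e (zero_add i)) 0, Ext.comp_zero]

theorem subsingleton_ext_of_retract_right (X : C) {Y Y' : C} (h : Retract Y Y') (i : ℕ)
    [Subsingleton (Ext X Y' i)] : Subsingleton (Ext X Y i) := by
  refine subsingleton_of_forall_eq 0 fun e => ?_
  have : (e.comp (Ext.mk₀ h.i) (add_zero i)).comp (Ext.mk₀ h.r) (add_zero i) = e := by simp
  rw [← this, Subsingleton.elim (e.comp (Ext.mk₀ h.i) (add_zero i)) 0, Ext.zero_comp]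

namespace CategoryTheory.ShortComplex.ShortExact

variable {S : ShortComplex C} (hS : S.ShortExact)

include hS

theorem subsingleton_ext_X₁_right (X : C) (i : ℕ) [Subsingleton (Ext X S.X₃ i)]
    [Subsingleton (Ext X S.X₂ (i + 1))] : Subsingleton (Ext X S.X₁ (i + 1)) := by
  refine subsingleton_of_forall_eq 0 fun e => ?_
  obtain ⟨y, rfl⟩ := Ext.covariant_sequence_exact₁ X hS e (Subsingleton.elim _ _) rfl
  rw [Subsingleton.elim y 0, Ext.zero_comp]

theorem subsingleton_ext_X₃_right (X : C) (i : ℕ) [Subsingleton (Ext X S.X₂ i)]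
    [Subsingleton (Ext X S.X₁ (i + 1))] : Subsingleton (Ext X S.X₃ i) := by
  refine subsingleton_of_forall_eq 0 fun e => ?_
  obtain ⟨y, rfl⟩ := Ext.covariant_sequence_exact₃ X hS e rfl (Subsingleton.elim _ _)
  rw [Subsingleton.elim y 0, Ext.zero_comp]

theorem subsingleton_ext_X₁_left (Y : C) (i : ℕ) [Subsingleton (Ext S.X₂ Y i)]
    [Subsingleton (Ext S.X₃ Y (i + 1))] : Subsingleton (Ext S.X₁ Y i) := by
  refine subsingleton_of_forall_eq 0 fun e => ?_
  obtain ⟨y, rfl⟩ := Ext.contravariant_sequence_exact₁ hS Y e (add_comm 1 i)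
    (Subsingleton.elim _ _)
  rw [Subsingleton.elim y 0, Ext.comp_zero]

end CategoryTheory.ShortComplex.ShortExact

end ExtVanishing

/-! ### `Ext` of modules and Baer's criterion in higher degrees -/

section ModuleExt

open Abelian

variable {A : Type u} [Ring A]

theorem subsingleton_ext_prod_right (X : ModuleCat.{u} A) (M N : Type u) [AddCommGroup M]
    [Module A M] [AddCommGroup N] [Module A N] (i : ℕ) :
    Subsingleton (Ext X (ModuleCat.of A (M × N)) i) ↔
      Subsingleton (Ext X (ModuleCat.of A M) i) ∧ Subsingleton (Ext X (ModuleCat.of A N) i) := by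
  have r₁ : Retract (ModuleCat.of A M) (ModuleCat.of A (M × N)) :=
    ⟨ModuleCat.ofHom (LinearMap.inl A M N), ModuleCat.ofHom (LinearMap.fst A M N), rfl⟩
  have r₂ : Retract (ModuleCat.of A N) (ModuleCat.of A (M × N)) :=
    ⟨ModuleCat.ofHom (LinearMap.inr A M N), ModuleCat.ofHom (LinearMap.snd A M N), rfl⟩
  refine ⟨fun _ => ⟨subsingleton_ext_of_retract_right X r₁ i,
    subsingleton_ext_of_retract_right X r₂ i⟩, fun ⟨_, _⟩ => ?_⟩
  have : Subsingleton (Ext X (ModuleCat.of A M ⊞ ModuleCat.of A N) i) :=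
    Ext.addEquivBiprod.toEquiv.subsingleton
  exact subsingleton_ext_of_retract_right X
    (ModuleCat.biprodIsoProd (ModuleCat.of A M) (ModuleCat.of A N)).symm.retract i

theorem subsingleton_ext_prod_left (M N : Type u) [AddCommGroup M]
    [Module A M] [AddCommGroup N] [Module A N] (Y : ModuleCat.{u} A) (i : ℕ) :
    Subsingleton (Ext (ModuleCat.of A (M × N)) Y i) ↔
      Subsingleton (Ext (ModuleCat.of A M) Y i) ∧ Subsingleton (Ext (ModuleCat.of A N) Y i) := by
  have r₁ : Retract (ModuleCat.of A M) (ModuleCat.of A (M × N)) :=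
    ⟨ModuleCat.ofHom (LinearMap.inl A M N), ModuleCat.ofHom (LinearMap.fst A M N), rfl⟩
  have r₂ : Retract (ModuleCat.of A N) (ModuleCat.of A (M × N)) :=
    ⟨ModuleCat.ofHom (LinearMap.inr A M N), ModuleCat.ofHom (LinearMap.snd A M N), rfl⟩
  refine ⟨fun _ => ⟨subsingleton_ext_of_retract_left r₁ Y i,
    subsingleton_ext_of_retract_left r₂ Y i⟩, fun ⟨_, _⟩ => ?_⟩
  have : Subsingleton (Ext (ModuleCat.of A M ⊞ ModuleCat.of A N) Y i) :=
    Ext.biprodAddEquiv.toEquiv.subsingleton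
  exact subsingleton_ext_of_retract_left
    (ModuleCat.biprodIsoProd (ModuleCat.of A M) (ModuleCat.of A N)).symm.retract Y i

theorem subsingleton_ext_pi_left (k : ℕ) (M : Type u) [AddCommGroup M]
    [Module A M] (Y : ModuleCat.{u} A) (i : ℕ) [Subsingleton (Ext (ModuleCat.of A M) Y i)] :
    Subsingleton (Ext (ModuleCat.of A (Fin k → M)) Y i) := by
  have : Subsingleton (Ext (⨁ fun _ : Fin k => ModuleCat.of A M) Y i) :=
    (Ext.biproductAddEquiv (Limits.biproduct.isBilimit _) Y i).toEquiv.subsingleton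
  exact subsingleton_ext_of_retract_left
    (ModuleCat.biproductIsoPi fun _ : Fin k => ModuleCat.of A M).symm.retract Y i

theorem subsingleton_ext_pi_right (X : ModuleCat.{u} A) (k : ℕ) (M : Type u) [AddCommGroup M]
    [Module A M] (i : ℕ) [Subsingleton (Ext X (ModuleCat.of A M) i)] :
    Subsingleton (Ext X (ModuleCat.of A (Fin k → M)) i) := by
  have : Subsingleton (Ext X (⨁ fun _ : Fin k => ModuleCat.of A M) i) :=
    (Ext.addEquivBiproduct X (Limits.biproduct.isBilimit _) i).toEquiv.subsingleton
  exact subsingleton_ext_of_retract_right X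
    (ModuleCat.biproductIsoPi fun _ : Fin k => ModuleCat.of A M).symm.retract i

theorem subsingleton_ext_self_zero_iff (M : Type u) [AddCommGroup M] [Module A M] :
    Subsingleton (Ext (ModuleCat.of A M) (ModuleCat.of A M) 0) ↔ Subsingleton M := by
  rw [Ext.homEquiv₀.subsingleton_congr]
  refine ⟨fun h => ?_, fun h => ⟨fun f g => by ext x; exact h.elim _ _⟩⟩
  refine subsingleton_of_forall_eq 0 fun x => ?_
  have := congrArg (fun f => f.hom x) (h.elim (𝟙 (ModuleCat.of A M)) 0)
  simpa using this

/-- Baer's criterion in higher degrees: it suffices to test `Ext` on cyclic modules. The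
induction replaces `M` by a cosyzygy; in degree one the connecting homomorphism turns the
vanishing of `Ext` into an extension of `I → M` to `A`. -/
theorem hasInjectiveDimensionLT_of_subsingleton_ext_cyclic (n : ℕ) (M : ModuleCat.{u} A)
    (h : ∀ I : Ideal A, Subsingleton (Ext (ModuleCat.of A (A ⧸ I)) M (n + 1))) :
    HasInjectiveDimensionLT M (n + 1) := by
  induction n generalizing M with
  | zero =>
    rw [zero_add, ← injective_iff_hasInjectiveDimensionLT_one]
    refine (Module.injective_iff_injective_object A M).1 (Module.Baer.injective fun I g => ?_)
    have hS := LinearMap.shortExact_shortComplexKer (Submodule.mkQ_surjective I)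
    have hk : LinearMap.ker I.mkQ = I := Submodule.ker_mkQ I
    let g' : LinearMap.ker I.mkQ →ₗ[A] M := g ∘ₗ (LinearEquiv.ofEq _ _ hk).toLinearMap
    have := h I
    obtain ⟨y, hy⟩ := Ext.contravariant_sequence_exact₁ hS M (Ext.mk₀ (ModuleCat.ofHom g'))
      (add_zero 1) (Subsingleton.elim (α := Ext (ModuleCat.of A (A ⧸ I)) M (0 + 1)) _ _)
    obtain ⟨φ, rfl⟩ := (Ext.mk₀_bijective _ _).2 y
    rw [Ext.mk₀_comp_mk₀] at hy
    have hy := (Ext.mk₀_bijective _ _).1 hy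
    refine ⟨φ.hom, fun x hx => ?_⟩
    exact congrArg (fun f => f.hom (⟨x, hk.symm ▸ hx⟩ : LinearMap.ker I.mkQ)) hy
  | succ n ih =>
    obtain ⟨⟨E, hE, f, hf⟩⟩ := EnoughInjectives.presentation M
    have hS : (ShortComplex.mk f (Limits.cokernel.π f) (by simp)).ShortExact :=
      { exact := ShortComplex.exact_cokernel f }
    have h2 : HasInjectiveDimensionLT (Limits.cokernel f) (n + 1) := ih _ fun I => by
      have := h I
      have := HasInjectiveDimensionLT.subsingleton E 1 (n + 1) (by lia)
        (ModuleCat.of A (A ⧸ I))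
      exact hS.subsingleton_ext_X₃_right (ModuleCat.of A (A ⧸ I)) (n + 1)
    exact hS.hasInjectiveDimensionLT_X₁ (n + 1) h2 inferInstance

end ModuleExt

/-! ### Matlis duality over a commutative Artinian ring -/

section MatlisDuality

variable {R : Type u} [CommRing R]

theorem isSemisimpleModule_quotient_jacobson [IsArtinianRing R] :
    IsSemisimpleModule R (R ⧸ Ring.jacobson R) :=
  (LinearMap.isSemisimpleModule_iff_of_bijective
    (σ := Ideal.Quotient.mk (Ring.jacobson R))
    ({ toFun := id, map_add' := fun _ _ => rfl, map_smul' := fun r x => by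
        simp [Algebra.smul_def] } :
      (R ⧸ Ring.jacobson R) →ₛₗ[Ideal.Quotient.mk (Ring.jacobson R)] (R ⧸ Ring.jacobson R))
    Function.bijective_id).2 inferInstance

theorem exists_surjective_of_isSimpleModule (S : Type u) [AddCommGroup S] [Module R S]
    [IsSimpleModule R S] : ∃ q : (R ⧸ Ring.jacobson R) →ₗ[R] S, Function.Surjective q := by
  have := IsSimpleModule.nontrivial R S
  obtain ⟨x, hx⟩ := exists_ne (0 : S)
  have h := IsSimpleModule.toSpanSingleton_surjective R hx
  refine ⟨Submodule.liftQ _ (LinearMap.toSpanSingleton R S x) fun r hr => ?_, fun y => ?_⟩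
  · exact Module.mem_annihilator.1 (IsSemisimpleModule.jacobson_le_annihilator R S hr) x
  · obtain ⟨r, rfl⟩ := h y
    exact ⟨Submodule.Quotient.mk r, rfl⟩

variable {J : Type u} [AddCommGroup J] [Module R J]

/-- `N` is reflexive for `J` if `Hom_R(N, J)` is Noetherian and evaluation identifies `N` with
`Hom_R(Hom_R(N, J), J)`. -/
def IsReflexiveModule (R : Type u) [CommRing R] (J : Type u) [AddCommGroup J] [Module R J]
    (N : Type u) [AddCommGroup N] [Module R N] : Prop :=
  IsNoetherian R (N →ₗ[R] J) ∧
    Function.Bijective (LinearMap.applyₗ : N →ₗ[R] (N →ₗ[R] J) →ₗ[R] J)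

namespace IsInjectiveEnvelope

variable [IsArtinianRing R] {ι : (R ⧸ Ring.jacobson R) →ₗ[R] J} (hι : IsInjectiveEnvelope ι)

include hι

/-- `J` is a cogenerator: every simple module embeds into `R / rad R`, hence into `J`. -/
theorem exists_apply_ne_zero {N : Type u} [AddCommGroup N] [Module R N] {x : N} (hx : x ≠ 0) :
    ∃ f : N →ₗ[R] J, f x ≠ 0 := by
  let P := Submodule.span R {x}
  let x' : P := ⟨x, Submodule.mem_span_singleton_self x⟩
  have hx' : ∀ m : Submodule R P, x' ∈ m → m = ⊤ := fun m hm => by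
    rw [eq_top_iff]
    rintro ⟨y, hy⟩ -
    obtain ⟨r, rfl⟩ := Submodule.mem_span_singleton.1 hy
    exact m.smul_mem r hm
  obtain ⟨m, hm, -⟩ := (eq_top_or_exists_le_coatom (⊥ : Submodule R P)).resolve_left fun h => hx <|
    congrArg Subtype.val ((Submodule.mem_bot R).1 (h.symm ▸ Submodule.mem_top : x' ∈ ⊥))
  have : IsSimpleModule R (P ⧸ m) := isSimpleModule_iff_isCoatom.2 hm
  have := isSemisimpleModule_quotient_jacobson (R := R)
  obtain ⟨q, hq⟩ := exists_surjective_of_isSimpleModule (R := R) (P ⧸ m)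
  obtain ⟨s, hs⟩ := IsSemisimpleModule.lifting_property q hq LinearMap.id
  obtain ⟨f, hf⟩ := hι.injective_module.out P.subtype P.subtype_injective (ι ∘ₗ s ∘ₗ m.mkQ)
  refine ⟨f, fun h => hm.1 (hx' m ?_)⟩
  have h0 : s (m.mkQ x') = 0 := (map_eq_zero_iff ι hι.injective).1 ((hf x').symm.trans h)
  have h1 : q (s (m.mkQ x')) = m.mkQ x' := LinearMap.congr_fun hs _
  rw [h0, map_zero] at h1
  exact (Submodule.Quotient.mk_eq_zero m).1 h1.symm

theorem applyₗ_injective (N : Type u) [AddCommGroup N] [Module R N] :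
    Function.Injective (LinearMap.applyₗ : N →ₗ[R] (N →ₗ[R] J) →ₗ[R] J) := by
  refine (injective_iff_map_eq_zero _).2 fun x h => ?_
  by_contra hx
  obtain ⟨f, hf⟩ := hι.exists_apply_ne_zero hx
  exact hf (LinearMap.congr_fun h f)

/-- `J` has no semisimple submodules beyond `R / rad R`: a complement of the intersection with
`R / rad R` would contradict essentiality. -/
theorem range_le_range (f : (R ⧸ Ring.jacobson R) →ₗ[R] J) :
    LinearMap.range f ≤ LinearMap.range ι := by
  have := isSemisimpleModule_quotient_jacobson (R := R)
  have := IsSemisimpleModule.range f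
  obtain ⟨C, hC⟩ := exists_isCompl ((LinearMap.range ι).submoduleOf (LinearMap.range f))
  have hC0 : C.map (LinearMap.range f).subtype = ⊥ := hι.essential _ <| by
    rw [Submodule.eq_bot_iff]
    rintro _ ⟨⟨y, hy, rfl⟩, hy'⟩
    have : y ∈ (LinearMap.range ι).submoduleOf (LinearMap.range f) ⊓ C := ⟨hy', hy⟩
    rw [hC.inf_eq_bot, Submodule.mem_bot] at this
    rw [this, map_zero]
  have hC1 : C = ⊥ := Submodule.map_injective_of_injective (Submodule.subtype_injective _)
    (by rw [hC0, Submodule.map_bot])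
  have := hC.sup_eq_top
  rw [hC1, sup_bot_eq] at this
  exact Submodule.submoduleOf_eq_top.1 this

/-- `Hom_R(R / rad R, J)` is isomorphic to `R / rad R`. -/
theorem nonempty_dual_quotient_jacobson :
    Nonempty ((R ⧸ Ring.jacobson R) ≃ₗ[R] ((R ⧸ Ring.jacobson R) →ₗ[R] J)) := by
  refine ⟨LinearEquiv.ofBijective
    ((LinearMap.llcomp R (R ⧸ Ring.jacobson R) _ J ι) ∘ₗ LinearMap.mul R _) ⟨?_, fun f => ?_⟩⟩
  · refine (injective_iff_map_eq_zero _).2 fun x h => ?_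
    have := LinearMap.congr_fun h 1
    simpa [map_eq_zero_iff ι hι.injective] using this
  · obtain ⟨x, hx⟩ := hι.range_le_range f ⟨1, rfl⟩
    refine ⟨x, LinearMap.ext fun y => ?_⟩
    obtain ⟨r, rfl⟩ := Submodule.mkQ_surjective _ y
    have h1 : Submodule.mkQ (Ring.jacobson R) r = r • (1 : R ⧸ Ring.jacobson R) := by
      rw [Algebra.smul_def, mul_one]; rfl
    rw [h1, map_smul, map_smul, ← hx]
    simp

theorem isReflexiveModule_quotient_jacobson :
    IsReflexiveModule R J (R ⧸ Ring.jacobson R) := by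
  obtain ⟨e⟩ := hι.nonempty_dual_quotient_jacobson
  refine ⟨isNoetherian_of_linearEquiv e, hι.applyₗ_injective _, ?_⟩
  -- the double dual is again isomorphic to `R / rad R`, which is Artinian
  let e' : (((R ⧸ Ring.jacobson R) →ₗ[R] J) →ₗ[R] J) ≃ₗ[R] (R ⧸ Ring.jacobson R) :=
    (LinearEquiv.congrLeft J R e.symm) ≪≫ₗ e.symm
  have h := IsArtinian.surjective_of_injective_endomorphism
    (e'.toLinearMap ∘ₗ LinearMap.applyₗ) (e'.injective.comp (hι.applyₗ_injective _))
  intro F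
  obtain ⟨x, hx⟩ := h (e' F)
  exact ⟨x, e'.injective hx⟩

theorem isReflexiveModule_of_surjective {N S : Type u} [AddCommGroup N] [Module R N]
    [AddCommGroup S] [Module R S] (q : N →ₗ[R] S) (hq : Function.Surjective q)
    (h : IsReflexiveModule R J N) : IsReflexiveModule R J S := by
  have hinj : Function.Injective (LinearMap.lcomp R J q) := fun f g hfg => by
    ext y
    obtain ⟨x, rfl⟩ := hq y
    exact LinearMap.congr_fun hfg x
  have := h.1
  refine ⟨isNoetherian_of_injective _ hinj, hι.applyₗ_injective _, fun F => ?_⟩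
  obtain ⟨F', hF'⟩ := hι.injective_module.out _ hinj F
  obtain ⟨x, hx⟩ := h.2.2 F'
  refine ⟨q x, LinearMap.ext fun g => ?_⟩
  rw [← hF', ← hx]
  rfl

/-- A linear form `F` on `Hom_R(N, J)` agrees on the maps factoring through `N ⧸ K` with evaluation
at some `n`; the difference is a linear form on `Hom_R(K, J)`, hence evaluation at some `k`. -/
theorem isReflexiveModule_of_submodule_of_quotient {N : Type u} [AddCommGroup N] [Module R N]
    (K : Submodule R N) (hK : IsReflexiveModule R J K) (hQ : IsReflexiveModule R J (N ⧸ K)) :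
    IsReflexiveModule R J N := by
  have := hK.1
  have := hQ.1
  -- restriction to `K` is surjective, with kernel the maps factoring through `N ⧸ K`
  have hres : Function.Surjective (LinearMap.lcomp R J K.subtype) := fun g =>
    let ⟨f, hf⟩ := hι.injective_module.out K.subtype K.subtype_injective g
    ⟨f, LinearMap.ext hf⟩
  have hker : LinearMap.range (LinearMap.lcomp R J K.mkQ) =
      LinearMap.ker (LinearMap.lcomp R J K.subtype) := by
    ext f
    refine ⟨?_, fun hf => ?_⟩
    swap
    · have hf' : K ≤ LinearMap.ker f := fun x hx => LinearMap.congr_fun hf ⟨x, hx⟩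
      exact ⟨K.liftQ f hf', K.liftQ_mkQ f hf'⟩
    rintro ⟨g, rfl⟩
    rw [LinearMap.mem_ker]
    ext x
    simp [(Submodule.Quotient.mk_eq_zero K).2 x.2]
  refine ⟨isNoetherian_of_range_eq_ker _ _ hker, hι.applyₗ_injective _, fun F => ?_⟩
  obtain ⟨y, hy⟩ := hQ.2.2 (F ∘ₗ LinearMap.lcomp R J K.mkQ)
  obtain ⟨n, rfl⟩ := K.mkQ_surjective y
  have hF : LinearMap.ker (LinearMap.lcomp R J K.subtype) ≤
      LinearMap.ker (F - LinearMap.applyₗ n) := by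
    rw [← hker]
    rintro _ ⟨g, rfl⟩
    rw [LinearMap.mem_ker, LinearMap.sub_apply, sub_eq_zero]
    exact (LinearMap.congr_fun hy g).symm
  let e := LinearMap.quotKerEquivOfSurjective _ hres
  obtain ⟨k, hk⟩ := hK.2.2 (Submodule.liftQ _ _ hF ∘ₗ e.symm.toLinearMap)
  refine ⟨n + k, LinearMap.ext fun f => ?_⟩
  have h1 := LinearMap.congr_fun hk (LinearMap.lcomp R J K.subtype f)
  have h2 : e.symm (LinearMap.lcomp R J K.subtype f) = Submodule.Quotient.mk f := by
    rw [LinearEquiv.symm_apply_eq]; rfl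
  rw [LinearMap.comp_apply, LinearEquiv.coe_coe, h2, Submodule.liftQ_apply] at h1
  have h3 : f k = F f - f n := h1
  change f (n + k) = F f
  rw [map_add, h3, add_sub_cancel]

/-- Modules of finite length are reflexive, by induction along a composition series; a simple
module is a quotient of `R / rad R`. -/
theorem isReflexiveModule_of_isFiniteLength {N : Type u} [AddCommGroup N] [Module R N]
    (hN : IsFiniteLength R N) : IsReflexiveModule R J N := by
  induction hN with
  | @of_subsingleton N _ _ _ =>
    exact hι.isReflexiveModule_of_surjective 0 (fun y => ⟨0, Subsingleton.elim _ _⟩)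
      hι.isReflexiveModule_quotient_jacobson
  | @of_simple_quotient N _ _ K _ _ ih =>
    obtain ⟨q, hq⟩ := exists_surjective_of_isSimpleModule (R := R) (N ⧸ K)
    exact hι.isReflexiveModule_of_submodule_of_quotient K ih
      (hι.isReflexiveModule_of_surjective q hq hι.isReflexiveModule_quotient_jacobson)

theorem isReflexiveModule (N : Type u) [AddCommGroup N] [Module R N] [Module.Finite R N] :
    IsReflexiveModule R J N :=
  hι.isReflexiveModule_of_isFiniteLength
    (isFiniteLength_iff_isNoetherian_isArtinian.2 ⟨inferInstance, inferInstance⟩)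

end IsInjectiveEnvelope

end MatlisDuality

/-! ### The duality from left to right modules -/

/-- For a left `A`-module `K` over an `R`-algebra `A`, this is `Hom_R(K, J)`, made into a right
`A`-module (a left `Aᵐᵒᵖ`-module) below by `(f · a)(x) = f(a x)`. -/
def RightDual (R : Type u) [CommRing R] (J : Type u) [AddCommGroup J] [Module R J]
    (K : Type u) [AddCommGroup K] [Module R K] : Type u :=
  K →ₗ[R] J

namespace RightDual

variable {R : Type u} [CommRing R] {J : Type u} [AddCommGroup J] [Module R J]

instance (K : Type u) [AddCommGroup K] [Module R K] : AddCommGroup (RightDual R J K) :=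
  inferInstanceAs (AddCommGroup (K →ₗ[R] J))

instance (K : Type u) [AddCommGroup K] [Module R K] : Module R (RightDual R J K) :=
  inferInstanceAs (Module R (K →ₗ[R] J))

instance (K : Type u) [AddCommGroup K] [Module R K] : FunLike (RightDual R J K) K J :=
  inferInstanceAs (FunLike (K →ₗ[R] J) K J)

instance (K : Type u) [AddCommGroup K] [Module R K] : LinearMapClass (RightDual R J K) R K J :=
  inferInstanceAs (LinearMapClass (K →ₗ[R] J) R K J)

variable {A : Type u} [Ring A] [Algebra R A]

section Action

variable {K : Type u} [AddCommGroup K] [Module R K] [Module A K] [IsScalarTower R A K]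

instance : Module Aᵐᵒᵖ (RightDual R J K) where
  smul a f := LinearMap.comp (show K →ₗ[R] J from f) (Algebra.lsmul R R K a.unop)
  one_smul f := LinearMap.ext fun x => congrArg f (one_smul A x)
  mul_smul a b f := LinearMap.ext fun x => congrArg f (mul_smul b.unop a.unop x)
  smul_zero _ := rfl
  smul_add _ _ _ := rfl
  add_smul a b f := LinearMap.ext fun x =>
    (congrArg f (add_smul a.unop b.unop x)).trans (map_add f _ _)
  zero_smul f := LinearMap.ext fun x => (congrArg f (zero_smul A x)).trans (map_zero f)

theorem smul_apply (a : Aᵐᵒᵖ) (f : RightDual R J K) (x : K) : (a • f) x = f (a.unop • x) := rfl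

@[ext]
theorem ext {f g : RightDual R J K} (h : ∀ x, f x = g x) : f = g := LinearMap.ext h

instance : IsScalarTower R Aᵐᵒᵖ (RightDual R J K) := .of_algebraMap_smul fun r f => by
  ext x
  change f (algebraMap R A r • x) = r • f x
  rw [algebraMap_smul, map_smul]

end Action

variable {K L : Type u} [AddCommGroup K] [Module R K] [Module A K] [IsScalarTower R A K]
  [AddCommGroup L] [Module R L] [Module A L] [IsScalarTower R A L]

/-- The transpose of an `A`-linear map. -/
def map (f : K →ₗ[A] L) : RightDual R J L →ₗ[Aᵐᵒᵖ] RightDual R J K where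
  toFun g := LinearMap.comp (show L →ₗ[R] J from g) (f.restrictScalars R)
  map_add' _ _ := rfl
  map_smul' a g := by
    ext x
    change g (a.unop • f x) = g (f (a.unop • x))
    rw [f.map_smul]

theorem map_injective {f : K →ₗ[A] L} (hf : Function.Surjective f) :
    Function.Injective (map (R := R) (J := J) f) := fun g h hgh => by
  ext y
  obtain ⟨x, rfl⟩ := hf y
  exact DFunLike.congr_fun hgh x

theorem map_surjective (hJ : Module.Injective R J) {f : K →ₗ[A] L} (hf : Function.Injective f) :
    Function.Surjective (map (R := R) (J := J) f) := fun g =>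
  let ⟨h, hh⟩ := hJ.out (f.restrictScalars R) hf g
  ⟨h, ext hh⟩

/-- The dual of the short exact sequence `0 → ker f → K → L → 0`. -/
theorem shortExact_map (hJ : Module.Injective R J) {f : K →ₗ[A] L} (hf : Function.Surjective f) :
    ∃ h : ModuleCat.ofHom (map (R := R) (J := J) f) ≫
        ModuleCat.ofHom (map (LinearMap.ker f).subtype) = 0,
      (ShortComplex.mk _ _ h).ShortExact := by
  have h0 : map (R := R) (J := J) (LinearMap.ker f).subtype ∘ₗ map f = 0 :=
    LinearMap.ext fun g => ext fun x => (congrArg g x.2).trans (map_zero g)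
  refine ⟨ModuleCat.hom_ext h0, ?_⟩
  · refine ModuleCat.shortComplex_shortExact _ (fun g => ⟨fun hg => ?_, ?_⟩) (map_injective hf)
      (map_surjective hJ (LinearMap.ker f).subtype_injective)
    · have hg' : LinearMap.ker (f.restrictScalars R) ≤ LinearMap.ker (show K →ₗ[R] J from g) :=
        fun x hx => DFunLike.congr_fun hg (⟨x, hx⟩ : LinearMap.ker f)
      let e := (f.restrictScalars R).quotKerEquivOfSurjective hf
      refine ⟨(Submodule.liftQ _ _ hg' ∘ₗ e.symm.toLinearMap : L →ₗ[R] J), ext fun x => ?_⟩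
      have h2 : e.symm (f x) = Submodule.Quotient.mk x := by
        rw [LinearEquiv.symm_apply_eq]; rfl
      change Submodule.liftQ _ _ hg' (e.symm (f x)) = g x
      rw [h2]
      rfl
    · rintro ⟨g', rfl⟩
      refine ext fun x => ?_
      exact (congrArg g' x.2).trans (map_zero g')

/-- The dual of a finite free left module is injective: a map `g` from a right ideal to the dual
of `Aᵏ` is determined by the `R`-linear maps `y ↦ g(y)(eᵢ)`, which extend to `A`. -/
theorem injective_pi (hJ : Module.Injective R J) (k : ℕ) :
    Module.Injective Aᵐᵒᵖ (RightDual R J (Fin k → A)) := by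
  refine Module.Baer.injective fun I g => ?_
  choose h hh using fun i : Fin k => hJ.out (I.restrictScalars R).subtype
    (Submodule.subtype_injective _)
    ({ toFun := fun y => g y (Pi.single i 1)
       map_add' := fun y z => DFunLike.congr_fun (g.map_add y z) (Pi.single i 1)
       map_smul' := fun r y => by
        have : g (r • y) = r • g y := (g.restrictScalars R).map_smul r y
        exact DFunLike.congr_fun this (Pi.single i 1) } : I.restrictScalars R →ₗ[R] J)
  let φ : RightDual R J (Fin k → A) := (∑ i, h i ∘ₗ
    (MulOpposite.opLinearEquiv R).toLinearMap ∘ₗ LinearMap.proj i : (Fin k → A) →ₗ[R] J)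
  have hφ (p : Fin k → A) : φ p = ∑ i, h i (MulOpposite.op (p i)) := by
    refine (LinearMap.sum_apply _ _ _).trans rfl
  refine ⟨LinearMap.toSpanSingleton Aᵐᵒᵖ _ φ, fun b hb => ext fun p => ?_⟩
  have hp : p = ∑ i, p i • Pi.single (M := fun _ => A) i 1 := by
    conv_lhs => rw [← Finset.univ_sum_single p]
    refine Finset.sum_congr rfl fun i _ => ?_
    rw [← Pi.single_smul, smul_eq_mul, mul_one]
  rw [LinearMap.toSpanSingleton_apply, smul_apply, hφ]
  conv_rhs => rw [hp, map_sum]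
  refine Finset.sum_congr rfl fun i _ => ?_
  have h1 := hh i (MulOpposite.op (p i) • ⟨b, hb⟩ : I)
  refine h1.trans ?_
  change g (MulOpposite.op (p i) • ⟨b, hb⟩) (Pi.single i 1) = _
  rw [map_smul]
  rfl

variable [IsArtinianRing R] [Module.Finite R A] {ι : (R ⧸ Ring.jacobson R) →ₗ[R] J}
  (hι : IsInjectiveEnvelope ι)

include hι

theorem subsingleton_iff : Subsingleton (RightDual R J K) ↔ Subsingleton K := by
  refine ⟨fun h => subsingleton_of_forall_eq 0 fun x => ?_,
    fun h => ⟨fun f g => ext fun x => ?_⟩⟩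
  · by_contra hx
    obtain ⟨f, hf⟩ := hι.exists_apply_ne_zero hx
    exact hf (DFunLike.congr_fun (h.elim (show RightDual R J K from f) 0) x)
  · rw [Subsingleton.elim x 0, map_zero, map_zero]

variable [Module.Finite A K]

/-- A retraction of the dual of a presentation `Aᵏ → K` dualizes, by reflexivity, to a section
of the presentation. -/
theorem projective_of_injective (h : Module.Injective Aᵐᵒᵖ (RightDual R J K)) :
    Module.Projective A K := by
  obtain ⟨k, π, hπ⟩ := Module.Finite.exists_fin' A K
  obtain ⟨ρ, hρ⟩ := h.out (map (R := R) (J := J) π) (map_injective hπ) LinearMap.id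
  have hev := (hι.isReflexiveModule (Fin k → A)).2
  have hs (x : K) : ∃ p : Fin k → A, ∀ φ : RightDual R J (Fin k → A), φ p = ρ φ x := by
    obtain ⟨p, hp⟩ := hev.2
      ((LinearMap.applyₗ x : (K →ₗ[R] J) →ₗ[R] J) ∘ₗ (ρ.restrictScalars R :
        RightDual R J (Fin k → A) →ₗ[R] RightDual R J K) : ((Fin k → A) →ₗ[R] J) →ₗ[R] J)
    exact ⟨p, fun φ => LinearMap.congr_fun hp φ⟩
  have huniq {p q : Fin k → A} (hpq : ∀ φ : RightDual R J (Fin k → A), φ p = φ q) : p = q :=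
    hev.1 (LinearMap.ext hpq)
  choose s hs using hs
  let σ : K →ₗ[A] (Fin k → A) :=
    { toFun := s
      map_add' := fun x y => huniq fun φ => by rw [map_add, hs, hs, hs, map_add]
      map_smul' := fun a x => huniq fun φ => by
        have h1 : φ (a • s x) = (MulOpposite.op a • φ) (s x) := rfl
        rw [RingHom.id_apply, h1, hs, hs, ρ.map_smul]
        rfl }
  refine Module.Projective.of_split σ π (LinearMap.ext fun x => ?_)
  refine hι.applyₗ_injective K (LinearMap.ext fun (ψ : RightDual R J K) => ?_)
  have h1 := hs x (map π ψ)
  rw [hρ] at h1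
  exact h1

omit [IsArtinianRing R] [Module.Finite R A] in
theorem injective_of_projective (h : Module.Projective A K) :
    Module.Injective Aᵐᵒᵖ (RightDual R J K) := by
  obtain ⟨k, π, hπ⟩ := Module.Finite.exists_fin' A K
  obtain ⟨σ, hσ⟩ := Module.projective_lifting_property π LinearMap.id hπ
  have := (Module.injective_iff_injective_object _ _).1
    (injective_pi (R := R) (A := A) hι.injective_module k)
  have r : Retract (ModuleCat.of Aᵐᵒᵖ (RightDual R J K))
      (ModuleCat.of Aᵐᵒᵖ (RightDual R J (Fin k → A))) :=
    ⟨ModuleCat.ofHom (map π), ModuleCat.ofHom (map σ), ModuleCat.hom_ext <| by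
      refine LinearMap.ext fun (g : RightDual R J K) => ext fun x => ?_
      exact congrArg g (LinearMap.congr_fun hσ x)⟩
  exact (Module.injective_iff_injective_object _ _).2 r.injective

end RightDual

namespace RightDual

variable {R : Type u} [CommRing R] [IsArtinianRing R] {A : Type u} [Ring A] [Algebra R A]
  [Module.Finite R A] {J : Type u} [AddCommGroup J] [Module R J]
  {ι : (R ⧸ Ring.jacobson R) →ₗ[R] J} (hι : IsInjectiveEnvelope ι)

include hι

/-- The duality exchanges projective and injective dimension. Syzygies of `K` with respect to
finite free modules dualize to cosyzygies, so everything reduces to the exchange of projective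
and injective modules. -/
theorem hasProjectiveDimensionLT_iff (n : ℕ) (K : Type u) [AddCommGroup K] [Module R K]
    [Module A K] [IsScalarTower R A K] [Module.Finite A K] :
    HasProjectiveDimensionLT (ModuleCat.of A K) n ↔
      HasInjectiveDimensionLT (ModuleCat.of Aᵐᵒᵖ (RightDual R J K)) n := by
  match n with
  | 0 =>
    rw [hasProjectiveDimensionLT_zero_iff_isZero, hasInjectiveDimensionLT_zero_iff_isZero,
      ModuleCat.isZero_of_iff_subsingleton, ModuleCat.isZero_of_iff_subsingleton,
      subsingleton_iff hι]
  | 1 =>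
    rw [← projective_iff_hasProjectiveDimensionLT_one, ← injective_iff_hasInjectiveDimensionLT_one,
      ← IsProjective.iff_projective, ← Module.injective_iff_injective_object]
    exact ⟨injective_of_projective hι, projective_of_injective hι⟩
  | n + 2 =>
    obtain ⟨k, π, hπ⟩ := Module.Finite.exists_fin' A K
    have : IsNoetherianRing A := isNoetherian_of_tower R inferInstance
    obtain ⟨h0, hS⟩ := shortExact_map (R := R) (J := J) hι.injective_module hπ
    have hS' := LinearMap.shortExact_shortComplexKer hπ
    refine (hS'.hasProjectiveDimensionLT_X₃_iff n
      ((IsProjective.iff_projective _).1 inferInstance)).trans (Iff.trans ?_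
        (hS.hasInjectiveDimensionLT_X₃_iff n
          ((Module.injective_iff_injective_object _ _).1 (injective_pi hι.injective_module k))))
    exact hasProjectiveDimensionLT_iff (n + 1) (LinearMap.ker π)

end RightDual

/-! ### The injective cogenerator `D(A)` -/

namespace ArtinDual

variable {R : Type u} [CommRing R] {A : Type u} [Ring A] [Algebra R A]
  {J : Type u} [AddCommGroup J] [Module R J]

instance (N : Type u) [AddCommGroup N] [Module R N] : Module R (ArtinDual R J N) :=
  inferInstanceAs (Module R (N →ₗ[R] J))

instance (N : Type u) [AddCommGroup N] [Module R N] : FunLike (ArtinDual R J N) N J :=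
  inferInstanceAs (FunLike (N →ₗ[R] J) N J)

instance (N : Type u) [AddCommGroup N] [Module R N] : LinearMapClass (ArtinDual R J N) R N J :=
  inferInstanceAs (LinearMapClass (N →ₗ[R] J) R N J)

@[ext]
theorem ext {N : Type u} [AddCommGroup N] [Module R N] {f g : ArtinDual R J N}
    (h : ∀ x, f x = g x) : f = g := LinearMap.ext h

theorem smul_apply (a : A) (f : ArtinDual R J A) (x : A) : (a • f) x = f (x * a) := rfl

instance : IsScalarTower R A (ArtinDual R J A) := .of_algebraMap_smul fun r f => by
  ext x
  change f (x * algebraMap R A r) = r • f x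
  rw [← Algebra.commutes, ← Algebra.smul_def, map_smul]

/-- `D(A)` is injective: a map `g` from a left ideal to `D(A)` is determined by the `R`-linear
map `y ↦ g(y)(1)`, which extends to `A`. -/
theorem injective (hJ : Module.Injective R J) : Module.Injective A (ArtinDual R J A) := by
  refine Module.Baer.injective fun I g => ?_
  obtain ⟨h, hh⟩ := hJ.out (I.restrictScalars R).subtype (Submodule.subtype_injective _)
    ({ toFun := fun y => g y 1
       map_add' := fun y z => DFunLike.congr_fun (g.map_add y z) 1
       map_smul' := fun r y => by
        have : g (r • y) = r • g y := (g.restrictScalars R).map_smul r y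
        exact DFunLike.congr_fun this 1 } : I.restrictScalars R →ₗ[R] J)
  refine ⟨LinearMap.toSpanSingleton A _ (show ArtinDual R J A from h), fun b hb => ext fun p => ?_⟩
  rw [LinearMap.toSpanSingleton_apply, smul_apply]
  refine (hh (p • ⟨b, hb⟩ : I)).trans ?_
  change g (p • ⟨b, hb⟩) 1 = _
  rw [map_smul, smul_apply, one_mul]

theorem subsingleton_prod_iff : Subsingleton (ArtinDual R J A × A) ↔ Subsingleton A := by
  refine ⟨fun h => ⟨fun x y => (Prod.ext_iff.1 (h.elim (0, x) (0, y))).2⟩, fun h => ?_⟩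
  have : Subsingleton (ArtinDual R J A) := ⟨fun f g => ext fun x => by
    rw [Subsingleton.elim x 0, map_zero, map_zero]⟩
  infer_instance

theorem hasInjectiveDimensionLT (hJ : Module.Injective R J) {n : ℕ}
    (h : HasInjectiveDimensionLT (ModuleCat.of A A) n) :
    HasInjectiveDimensionLT (ModuleCat.of A (ArtinDual R J A)) n := by
  cases n with
  | zero =>
    rw [hasInjectiveDimensionLT_zero_iff_isZero, ModuleCat.isZero_of_iff_subsingleton] at h ⊢
    have := (subsingleton_prod_iff (R := R) (J := J)).2 h
    exact (Prod.fst_surjective (β := A)).subsingleton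
  | succ n =>
    have := (Module.injective_iff_injective_object _ _).1 (injective (A := A) hJ)
    infer_instance

variable [IsArtinianRing R] [Module.Finite R A] {ι : (R ⧸ Ring.jacobson R) →ₗ[R] J}
  (hι : IsInjectiveEnvelope ι)

include hι

theorem finite : Module.Finite A (ArtinDual R J A) := by
  have : IsNoetherian R (ArtinDual R J A) := (hι.isReflexiveModule A).1
  exact Module.Finite.of_restrictScalars_finite R A _

/-- Evaluation identifies `A`, as a right module, with the dual of `D(A)`. -/
theorem nonempty_rightDual_equiv :
    Nonempty (A ≃ₗ[Aᵐᵒᵖ] RightDual R J (ArtinDual R J A)) :=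
  ⟨LinearEquiv.ofBijective
    { toFun := fun x => show RightDual R J (ArtinDual R J A) from
        (LinearMap.applyₗ x : (A →ₗ[R] J) →ₗ[R] J)
      map_add' := fun x y => map_add LinearMap.applyₗ x y
      map_smul' := fun _ _ => rfl } (hι.isReflexiveModule A).2⟩

/-- A finitely generated module embeds into a finite power of `D(A)`. -/
theorem exists_injective (X : Type u) [AddCommGroup X] [Module R X] [Module A X]
    [IsScalarTower R A X] [Module.Finite A X] :
    ∃ (k : ℕ) (f : X →ₗ[A] (Fin k → ArtinDual R J A)), Function.Injective f := by
  have : Module.Finite R X := Module.Finite.trans A X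
  have : IsArtinian A X := isArtinian_of_tower R inferInstance
  -- the map corresponding to a linear form under `Hom_A(X, D(A)) = Hom_R(X, J)`
  let Φ (f : X →ₗ[R] J) : X →ₗ[A] ArtinDual R J A :=
    { toFun := fun x => (f ∘ₗ (LinearMap.toSpanSingleton A X x).restrictScalars R : A →ₗ[R] J)
      map_add' := fun x y => ext fun a => by
        change f (a • (x + y)) = f (a • x) + f (a • y)
        rw [smul_add, map_add]
      map_smul' := fun b x => ext fun a => by
        change f (a • b • x) = f ((a * b) • x)
        rw [mul_smul] }
  obtain ⟨s, hs⟩ := Finset.exists_inf_le fun f : X →ₗ[R] J => LinearMap.ker (Φ f)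
  refine ⟨s.card, LinearMap.pi fun i => Φ (s.equivFin.symm i), ?_⟩
  refine (injective_iff_map_eq_zero _).2 fun x hx => ?_
  by_contra hx0
  obtain ⟨f, hf⟩ := hι.exists_apply_ne_zero hx0
  refine hf ?_
  have hx' : x ∈ s.inf fun f : X →ₗ[R] J => LinearMap.ker (Φ f) := by
    rw [Submodule.mem_finsetInf]
    intro g hg
    have := congrFun hx (s.equivFin ⟨g, hg⟩)
    simpa using this
  have h1 : Φ f x = 0 := hs f hx'
  have h2 : f ((1 : A) • x) = 0 := DFunLike.congr_fun h1 1
  rwa [one_smul] at h2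

end ArtinDual

/-- The injective dimension of `A` as a right module is the projective dimension of `D(A)`. -/
theorem hasProjectiveDimensionLT_artinDual_iff {R : Type u} [CommRing R] [IsArtinianRing R]
    {A : Type u} [Ring A] [Algebra R A] [Module.Finite R A] {J : Type u} [AddCommGroup J]
    [Module R J] {ι : (R ⧸ Ring.jacobson R) →ₗ[R] J} (hι : IsInjectiveEnvelope ι) (n : ℕ) :
    HasProjectiveDimensionLT (ModuleCat.of A (ArtinDual R J A)) n ↔
      HasInjectiveDimensionLT (ModuleCat.of Aᵐᵒᵖ A) n := by
  have := ArtinDual.finite (A := A) hι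
  obtain ⟨e⟩ := ArtinDual.nonempty_rightDual_equiv (A := A) hι
  rw [RightDual.hasProjectiveDimensionLT_iff hι]
  exact ⟨fun _ => hasInjectiveDimensionLT_of_iso e.toModuleIso.symm n,
    fun _ => hasInjectiveDimensionLT_of_iso e.toModuleIso n⟩

/-! ### Extension degrees -/

theorem exists_natCast_lt {d : WithBot ℕ∞} (h : d < ⊤) : ∃ n : ℕ, d < (n : WithBot ℕ∞) := by
  induction d with
  | bot => exact ⟨0, WithBot.bot_lt_coe _⟩
  | coe d =>
    obtain ⟨n, rfl⟩ := ENat.ne_top_iff_exists.1 (WithBot.coe_lt_coe.1 h).ne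
    exact ⟨n + 1, by exact_mod_cast Nat.lt_succ_self n⟩

/-- Elements of `{-∞} ∪ ℕ ∪ {∞}` are compared through their strict upper bounds in `ℕ`. Strict
bounds are used because `-∞ < 0` makes the zero module no exception. -/
theorem withBot_le_of_forall_lt {d e : WithBot ℕ∞} (h : ∀ n : ℕ, d < n → e < n) : e ≤ d := by
  by_cases hd : d < ⊤
  · obtain ⟨n, hn⟩ := exists_natCast_lt hd
    induction n with
    | zero =>
      rw [(WithBot.lt_zero_iff_eq_bot e).1 (h 0 hn)]
      exact bot_le
    | succ n ih =>
      by_cases hn' : d < n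
      · exact ih hn'
      · refine le_trans ?_ (not_lt.1 hn')
        have := h _ hn
        rw [Nat.cast_add, Nat.cast_one] at this
        exact ENat.WithBot.lt_add_one_iff.1 this
  · rw [not_lt_top_iff.1 hd]
    exact le_top

section ExtDeg

open Abelian

variable {A : Type u} [Ring A]

theorem le_extDeg (M : Type u) [AddCommGroup M] [Module A M] (i : ℕ)
    (h : ¬ Subsingleton (Ext (ModuleCat.of A M) (ModuleCat.of A M) i)) :
    (i : WithBot ℕ∞) ≤ extDeg A M :=
  le_sSup ⟨i, rfl, not_subsingleton_iff_nontrivial.1 h⟩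

theorem extDeg_lt_iff (M : Type u) [AddCommGroup M] [Module A M] (n : ℕ) :
    extDeg A M < n ↔ ∀ i : ℕ, n ≤ i →
      Subsingleton (Ext (ModuleCat.of A M) (ModuleCat.of A M) i) := by
  refine ⟨fun h i hi => ?_, fun h => ?_⟩
  · by_contra hs
    exact ((le_extDeg M i hs).trans_lt h).not_ge (by exact_mod_cast hi)
  · have key (d : ℕ) (hd : ∃ i : ℕ, (d : WithBot ℕ∞) = i ∧
        Nontrivial (Ext (ModuleCat.of A M) (ModuleCat.of A M) i)) : d < n := by
      obtain ⟨i, hdi, hi⟩ := hd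
      obtain rfl : d = i := by exact_mod_cast hdi
      by_contra hd'
      exact not_subsingleton_iff_nontrivial.2 hi (h d (not_lt.1 hd'))
    cases n with
    | zero =>
      refine lt_of_le_of_lt (sSup_le ?_) (WithBot.bot_lt_coe _)
      rintro _ ⟨i, rfl, hi⟩
      exact absurd (key i ⟨i, rfl, hi⟩) (Nat.not_lt_zero i)
    | succ n =>
      rw [Nat.cast_add, Nat.cast_one, ENat.WithBot.lt_add_one_iff]
      refine sSup_le ?_
      rintro _ ⟨i, rfl, hi⟩
      exact_mod_cast Nat.lt_succ_iff.1 (key i ⟨i, rfl, hi⟩)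

end ExtDeg

/-! ### Finite finitistic extension degree -/

section FinitisticExtDeg

open Abelian

variable {A : Type u} [Ring A]

/-- `Ext^i(X, Y)` vanishes for all large `i`. -/
def EventuallyExtZero (X Y : ModuleCat.{u} A) : Prop :=
  ∃ n : ℕ, ∀ i, n < i → Subsingleton (Ext X Y i)

theorem eventuallyExtZero_prod {M N : Type u} [AddCommGroup M] [Module A M] [AddCommGroup N]
    [Module A N] (hMM : EventuallyExtZero (ModuleCat.of A M) (ModuleCat.of A M))
    (hMN : EventuallyExtZero (ModuleCat.of A M) (ModuleCat.of A N))
    (hNM : EventuallyExtZero (ModuleCat.of A N) (ModuleCat.of A M))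
    (hNN : EventuallyExtZero (ModuleCat.of A N) (ModuleCat.of A N)) :
    EventuallyExtZero (ModuleCat.of A (M × N)) (ModuleCat.of A (M × N)) := by
  obtain ⟨a, ha⟩ := hMM
  obtain ⟨b, hb⟩ := hMN
  obtain ⟨c, hc⟩ := hNM
  obtain ⟨d, hd⟩ := hNN
  refine ⟨a + b + c + d, fun i hi => ?_⟩
  rw [subsingleton_ext_prod_right, subsingleton_ext_prod_left, subsingleton_ext_prod_left]
  exact ⟨⟨ha i (by lia), hc i (by lia)⟩, hb i (by lia), hd i (by lia)⟩

section Syzygy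

variable {r : ℕ} {M : ModuleCat.{u} A} {π : (Fin r → A) →ₗ[A] M} (hπ : Function.Surjective π)

include hπ

theorem eventuallyExtZero_ker_right (Z : ModuleCat.{u} A) :
    EventuallyExtZero Z M → EventuallyExtZero Z (ModuleCat.of A A) →
      EventuallyExtZero Z (ModuleCat.of A (LinearMap.ker π)) := by
  rintro ⟨m, hm⟩ ⟨n, hn⟩
  refine ⟨m + n + 1, fun i hi => ?_⟩
  obtain ⟨i, rfl⟩ : ∃ j, i = j + 1 := ⟨i - 1, by lia⟩
  have := hm i (by lia)
  have := hn (i + 1) (by lia)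
  have := subsingleton_ext_pi_right Z r A (i + 1)
  exact (LinearMap.shortExact_shortComplexKer hπ).subsingleton_ext_X₁_right Z i

theorem eventuallyExtZero_ker_left (Z : ModuleCat.{u} A) :
    EventuallyExtZero M Z → EventuallyExtZero (ModuleCat.of A (LinearMap.ker π)) Z := by
  rintro ⟨m, hm⟩
  refine ⟨m, fun i hi => ?_⟩
  have := hm (i + 1) (by lia)
  have := HasProjectiveDimensionLT.subsingleton (ModuleCat.of A (Fin r → A)) 1 i (by lia) Z
  exact (LinearMap.shortExact_shortComplexKer hπ).subsingleton_ext_X₁_left Z i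

end Syzygy

variable [IsNoetherianRing A]

/-- If `pd M > k`, the `(k + 1)`-st syzygy `Y` of `M` satisfies `Ext^{k+1}(M, Y) ≠ 0`: by
dimension shifting this is `Ext^1` of the `k`-th syzygy with values in the next one, which contains
the class of a nonsplit extension. Eventual vanishing passes from `M` to `Y` in either variable. -/
theorem exists_syzygy (k : ℕ) (M : ModuleCat.{u} A) [Module.Finite A M]
    (h : ¬ HasProjectiveDimensionLT M (k + 1)) :
    ∃ Y : ModuleCat.{u} A, Module.Finite A Y ∧ ¬ Subsingleton (Ext M Y (k + 1)) ∧
      (∀ Z, EventuallyExtZero Z M → EventuallyExtZero Z (ModuleCat.of A A) →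
        EventuallyExtZero Z Y) ∧
      ∀ Z, EventuallyExtZero M Z → EventuallyExtZero Y Z := by
  induction k generalizing M with
  | zero =>
    obtain ⟨r, π, hπ⟩ := Module.Finite.exists_fin' A M
    have hS := LinearMap.shortExact_shortComplexKer hπ
    refine ⟨ModuleCat.of A (LinearMap.ker π), inferInstance, fun h1 => h ?_,
      eventuallyExtZero_ker_right hπ, eventuallyExtZero_ker_left hπ⟩
    -- if `Ext^1` vanishes, the identity of `M` lifts along `π`
    obtain ⟨σ, hσ⟩ := Ext.covariant_sequence_exact₃ M hS (Ext.mk₀ (𝟙 M)) (zero_add 1)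
      (h1.elim _ _)
    obtain ⟨σ, rfl⟩ := (Ext.mk₀_bijective _ _).2 σ
    rw [Ext.mk₀_comp_mk₀] at hσ
    have r : Retract M (ModuleCat.of A (Fin r → A)) :=
      ⟨σ, ModuleCat.ofHom π, (Ext.mk₀_bijective _ _).1 hσ⟩
    exact r.hasProjectiveDimensionLT 1
  | succ k ih =>
    obtain ⟨r, π, hπ⟩ := Module.Finite.exists_fin' A M
    have hS := LinearMap.shortExact_shortComplexKer hπ
    have hP : Projective (ModuleCat.of A (Fin r → A)) :=
      (IsProjective.iff_projective _).1 inferInstance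
    obtain ⟨Y, hY, h1, h2, h3⟩ := ih (ModuleCat.of A (LinearMap.ker π))
      fun h' => h ((hS.hasProjectiveDimensionLT_X₃_iff k hP).2 h')
    refine ⟨Y, hY, fun h4 => h1 ?_, fun Z hM hA => h2 Z (eventuallyExtZero_ker_right hπ Z hM hA) hA,
      fun Z hM => h3 Z (eventuallyExtZero_ker_left hπ Z hM)⟩
    have := HasProjectiveDimensionLT.subsingleton (ModuleCat.of A (Fin r → A)) 1 (k + 1)
      (by lia) Y
    exact hS.subsingleton_ext_X₁_left Y (k + 1)

/-- If `fed A < ∞` and `Ext^i(M, M ⊕ A)` vanishes for large `i`, then `pd M < ∞`. Otherwise the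
modules `M ⊕ Y`, with `Y` a syzygy of `M`, would have finite but unbounded extension degrees. -/
theorem exists_hasProjectiveDimensionLT (hA : finitisticExtDeg A < ⊤) (M : ModuleCat.{u} A)
    [Module.Finite A M] (hMM : EventuallyExtZero M M)
    (hMA : EventuallyExtZero M (ModuleCat.of A A)) : ∃ n : ℕ, HasProjectiveDimensionLT M n := by
  obtain ⟨N, hN⟩ := exists_natCast_lt hA
  by_contra! h
  obtain ⟨Y, hY, h1, h2, h3⟩ := exists_syzygy N M (h (N + 1))
  have hX := eventuallyExtZero_prod hMM (h2 M hMM hMA) (h3 M hMM)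
    (h2 Y (h3 M hMM) (h3 _ hMA))
  have hfin : extDeg A (M × Y) < ⊤ := by
    obtain ⟨n, hn⟩ := hX
    exact ((extDeg_lt_iff _ (n + 1)).2 hn).trans (WithBot.coe_lt_coe.2 (ENat.natCast_lt_top _))
  have hle : extDeg A (M × Y) ≤ finitisticExtDeg A :=
    le_sSup ⟨hfin, M × Y, inferInstance, inferInstance, inferInstance, rfl⟩
  have hge : ((N + 1 : ℕ) : WithBot ℕ∞) ≤ extDeg A (M × Y) := le_extDeg _ _ fun h4 => h1
    ((subsingleton_ext_prod_right _ _ _ _).1 ((subsingleton_ext_prod_left _ _ _ _).1 h4).1).2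
  have := (hge.trans hle).trans_lt hN
  norm_cast at this
  lia

end FinitisticExtDeg

/-! ### Comparison of the three dimensions -/

section Comparison

open Abelian

variable {R A : Type u} [CommRing R] [IsArtinianRing R] [Ring A] [Algebra R A]
  [Module.Finite R A] {J : Type u} [AddCommGroup J] [Module R J]
  {ι : (R ⧸ Ring.jacobson R) →ₗ[R] J} (hι : IsInjectiveEnvelope ι)

include hι

omit [IsArtinianRing R] [Module.Finite R A] in
theorem extDeg_le_leftSelfInjDim : extDeg A (ArtinDual R J A × A) ≤ leftSelfInjDim A := by
  refine withBot_le_of_forall_lt fun n hn => (extDeg_lt_iff _ n).2 fun i hi => ?_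
  have h1 := injectiveDimension_lt_iff.1 hn
  have h2 := ArtinDual.hasInjectiveDimensionLT hι.injective_module h1
  exact (subsingleton_ext_prod_right _ _ _ _).2
    ⟨HasInjectiveDimensionLT.subsingleton _ n i hi _,
      HasInjectiveDimensionLT.subsingleton _ n i hi _⟩

theorem extDeg_le_rightSelfInjDim : extDeg A (ArtinDual R J A × A) ≤ rightSelfInjDim A := by
  refine withBot_le_of_forall_lt fun n hn => (extDeg_lt_iff _ n).2 fun i hi => ?_
  have h1 := injectiveDimension_lt_iff.1 hn
  have h2 := (hasProjectiveDimensionLT_artinDual_iff hι n).2 h1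
  have h3 : HasProjectiveDimensionLT (ModuleCat.of A A) n := by
    cases n with
    | zero =>
      rw [hasInjectiveDimensionLT_zero_iff_isZero, ModuleCat.isZero_of_iff_subsingleton] at h1
      rwa [hasProjectiveDimensionLT_zero_iff_isZero, ModuleCat.isZero_of_iff_subsingleton]
    | succ n => infer_instance
  exact (subsingleton_ext_prod_left _ _ _ _).2
    ⟨HasProjectiveDimensionLT.subsingleton _ n i hi _,
      HasProjectiveDimensionLT.subsingleton _ n i hi _⟩

/-- (GARC) applied to `D(A) ⊕ A` bounds `pd D(A)`, which is the right self-injective dimension. -/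
theorem rightSelfInjDim_le_extDeg (hA : SatisfiesGARC A) :
    rightSelfInjDim A ≤ extDeg A (ArtinDual R J A × A) := by
  refine withBot_le_of_forall_lt fun n hn => injectiveDimension_lt_iff.2 ?_
  rw [extDeg_lt_iff] at hn
  cases n with
  | zero =>
    rw [hasInjectiveDimensionLT_zero_iff_isZero, ModuleCat.isZero_of_iff_subsingleton]
    exact (ArtinDual.subsingleton_prod_iff (R := R) (J := J)).1
      ((subsingleton_ext_self_zero_iff _).1 (hn 0 le_rfl))
  | succ n =>
    have := ArtinDual.finite (A := A) hι
    have h := hA (ArtinDual R J A × A) n fun i hi => (subsingleton_ext_prod_right _ _ _ _).2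
      ⟨hn i hi, ((subsingleton_ext_prod_right _ _ _ _).1 (hn i hi)).2⟩
    have := (projectiveDimension_le_iff _ _).1 h
    rw [← hasProjectiveDimensionLT_artinDual_iff hι]
    have r : Retract (ModuleCat.of A (ArtinDual R J A))
        (ModuleCat.of A (ArtinDual R J A × A)) :=
      ⟨ModuleCat.ofHom (LinearMap.inl A _ _), ModuleCat.ofHom (LinearMap.fst A _ _), rfl⟩
    exact r.hasProjectiveDimensionLT (n + 1)

/-- If `id A ≤ n + 1`, then `Ext^{n+1}(-, A)` turns injections into surjections, so its vanishing
on `D(A)` implies its vanishing on submodules of finite powers of `D(A)`,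
hence on all cyclic modules. -/
theorem hasInjectiveDimensionLT_of_succ (n : ℕ)
    (h : HasInjectiveDimensionLT (ModuleCat.of A A) (n + 2))
    [Subsingleton (Ext (ModuleCat.of A (ArtinDual R J A)) (ModuleCat.of A A) (n + 1))] :
    HasInjectiveDimensionLT (ModuleCat.of A A) (n + 1) := by
  refine hasInjectiveDimensionLT_of_subsingleton_ext_cyclic n _ fun I => ?_
  obtain ⟨k, f, hf⟩ := ArtinDual.exists_injective (A := A) hι (A ⧸ I)
  have := (ModuleCat.mono_iff_injective (ModuleCat.ofHom f)).2 hf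
  have hS : (ShortComplex.mk (ModuleCat.ofHom f) (Limits.cokernel.π (ModuleCat.ofHom f))
      (by simp)).ShortExact :=
    { exact := ShortComplex.exact_cokernel _ }
  have := HasInjectiveDimensionLT.subsingleton (ModuleCat.of A A) (n + 2) (n + 2) le_rfl
    (Limits.cokernel (ModuleCat.ofHom f))
  have := subsingleton_ext_pi_left k (ArtinDual R J A) (ModuleCat.of A A) (n + 1)
  exact hS.subsingleton_ext_X₁_left (ModuleCat.of A A) (n + 1)

/-- If `id A = n` with `1 ≤ n < ∞`, then `Ext^n(D(A), A) ≠ 0`, which gives a self-extension of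
`D(A) ⊕ A` in degree `n`; in degree `0` it suffices that `A ≠ 0`. -/
theorem leftSelfInjDim_le_extDeg (hA : leftSelfInjDim A < ⊤) :
    leftSelfInjDim A ≤ extDeg A (ArtinDual R J A × A) := by
  refine withBot_le_of_forall_lt fun n hn => injectiveDimension_lt_iff.2 ?_
  rw [extDeg_lt_iff] at hn
  obtain ⟨m, hm⟩ := exists_natCast_lt hA
  replace hm := injectiveDimension_lt_iff.1 hm
  -- descend from a bound `m` to the bound `n`
  induction m with
  | zero => exact hasInjectiveDimensionLT_of_ge _ 0 n n.zero_le
  | succ m ih =>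
    by_cases hmn : m + 1 ≤ n
    · exact hasInjectiveDimensionLT_of_ge _ (m + 1) n hmn
    · refine ih ?_
      have h := hn m (by lia)
      cases m with
      | zero =>
        rw [hasInjectiveDimensionLT_zero_iff_isZero, ModuleCat.isZero_of_iff_subsingleton]
        exact (ArtinDual.subsingleton_prod_iff (R := R) (J := J)).1
          ((subsingleton_ext_self_zero_iff _).1 h)
      | succ m =>
        have := ((subsingleton_ext_prod_left _ _ _ _).1
          ((subsingleton_ext_prod_right _ _ _ _).1 h).2).1
        exact hasInjectiveDimensionLT_of_succ hι m hm

theorem rightSelfInjDim_lt_top_of_finitisticExtDeg (hfed : finitisticExtDeg A < ⊤)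
    (hA : leftSelfInjDim A < ⊤) : rightSelfInjDim A < ⊤ := by
  have : IsNoetherianRing A := isNoetherian_of_tower R inferInstance
  have := ArtinDual.finite (A := A) hι
  have := (Module.injective_iff_injective_object _ _).1
    (ArtinDual.injective (A := A) hι.injective_module)
  obtain ⟨m, hm⟩ := exists_natCast_lt hA
  have := injectiveDimension_lt_iff.1 hm
  obtain ⟨n, hn⟩ := exists_hasProjectiveDimensionLT hfed (ModuleCat.of A (ArtinDual R J A))
    ⟨0, fun i hi => HasInjectiveDimensionLT.subsingleton _ 1 i hi _⟩
    ⟨m, fun i hi => HasInjectiveDimensionLT.subsingleton _ m i hi.le _⟩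
  exact (injectiveDimension_lt_iff.2 ((hasProjectiveDimensionLT_artinDual_iff hι n).1 hn)).trans
    (WithBot.coe_lt_coe.2 (ENat.natCast_lt_top n))

end Comparison

theorem mainTheorem5 (R A : Type u) [CommRing R] [IsArtinianRing R] [Ring A] [Algebra R A]
    [Module.Finite R A] :
    (SatisfiesGARC A →
      (∀ (J : Type u) [AddCommGroup J] [Module R J] (ι : (R ⧸ Ring.jacobson R) →ₗ[R] J),
        IsInjectiveEnvelope ι →
          rightSelfInjDim A = extDeg A (ArtinDual R J A × A) ∧
          extDeg A (ArtinDual R J A × A) ≤ leftSelfInjDim A ∧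
          (leftSelfInjDim A < ⊤ →
            extDeg A (ArtinDual R J A × A) = leftSelfInjDim A)) ∧
      (leftSelfInjDim A < ⊤ →
        rightSelfInjDim A = leftSelfInjDim A ∧ IsGorensteinRing A)) ∧
    (finitisticExtDeg A < ⊤ → leftSelfInjDim A < ⊤ → rightSelfInjDim A < ⊤) := by
  obtain ⟨J₀, _, _, ι₀, hι₀⟩ := exists_injectiveEnvelope R (R ⧸ Ring.jacobson R)
  refine ⟨fun hA => ⟨fun J _ _ ι hι => ⟨?_, extDeg_le_leftSelfInjDim hι, fun hl => ?_⟩,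
    fun hl => ?_⟩, rightSelfInjDim_lt_top_of_finitisticExtDeg hι₀⟩
  · exact (rightSelfInjDim_le_extDeg hι hA).antisymm (extDeg_le_rightSelfInjDim hι)
  · exact (extDeg_le_leftSelfInjDim hι).antisymm (leftSelfInjDim_le_extDeg hι hl)
  · have h : rightSelfInjDim A = leftSelfInjDim A :=
      ((rightSelfInjDim_le_extDeg hι₀ hA).trans (extDeg_le_leftSelfInjDim hι₀)).antisymm
        ((leftSelfInjDim_le_extDeg hι₀ hl).trans (extDeg_le_rightSelfInjDim hι₀))
    exact ⟨h, hl, h ▸ hl⟩
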